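/- Let $m,n\ge 1$ be integers and let $G$ be a finite abelian group with $G\simeq C_m\oplus C_{mn}$, where $C_k$ denotes the cyclic group of order $k$. A finite sequence $S=(g_1,\dots,g_\ell)$ of elements of $G$ (repetitions allowed), of length $|S|=\ell\ge 0$, is called zero-sumfree if $\sum_{i\in I}g_i\neq 0$ for every non-empty $I\subseteq\{1,\dots,\ell\}$; let $\mathsf d(G)$ be the largest length of a zero-sumfree sequence in $G$. Then $\mathsf d(G)=m+mn-2$, and for every zero-sumfree sequence $S$ in $G$ with $|S|=\mathsf d(G)=m+mn-2$ the following two statements hold, where elements of $S$ are counted with multiplicity. (i) If $n$ is a prime power, that is, $n=p^a$ with $p$ prime and $a\ge 0$ (so that $n=1$ is included), then $S$ contains at least $mn-1$ elements of order $mn$. (ii) If $n$ is not a prime power, then $S$ contains at least $\left\lceil \frac45 mn+\frac{n-5}{5}\right\rceil$ elements of order $mn$. -/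

import Mathlib

/-- The subsums of a finite sequence `S = (g_1, …, g_ℓ)`: sums over non-empty sets of indices. -/
def subsums {G : Type*} [AddCommGroup G] {ℓ : ℕ} (S : Fin ℓ → G) : Set G :=
  {s | ∃ I : Finset (Fin ℓ), I.Nonempty ∧ s = ∑ i ∈ I, S i}

/-- A sequence is zero-sumfree if `0` is not one of its subsums. -/
def IsZeroSumfree {G : Type*} [AddCommGroup G] {ℓ : ℕ} (S : Fin ℓ → G) : Prop :=
  (0 : G) ∉ subsums S

/-- `d(G)`: the largest length of a zero-sumfree sequence in `G` (for finite `G` these lengths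
form a bounded set, which contains `0`, so that the supremum is attained). -/
noncomputable def maxZeroSumfreeLength (G : Type*) [AddCommGroup G] : ℕ :=
  sSup {ℓ : ℕ | ∃ S : Fin ℓ → G, IsZeroSumfree S}

/-- The number of elements of order `d` in the sequence `S`, counted with multiplicity. -/
noncomputable def orderCount {G : Type*} [AddCommGroup G] {ℓ : ℕ} (S : Fin ℓ → G) (d : ℕ) : ℕ :=
  (Finset.univ.filter fun i : Fin ℓ => addOrderOf (S i) = d).card

/-! Everything rests on contraction: modulo a prime `q`, split a sequence into disjoint blocks whose
sums vanish in `C_q` or `C_q ⊕ C_q`, then apply the Davenport bound of the smaller group to the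
block sums. Chevalley–Warning supplies the blocks, and induction gives `davenportBound`. At maximal
length, terms that already vanish modulo `q` are blocks of size one and save length. If `q ∣ m`, a
single such term in `C_q ⊕ C_q` forces a zero-sum (`not_dvd_of_zero_sumfree`); if `q ∣ n`, then `m`
terms with second coordinate divisible by `q` do (`card_filter_dvd_lt_of_zero_sumfree`). Hence each
prime divisor of `n` accounts for at most `m - 1` terms of order other than `m * n`, and no other
prime contributes. Both counts follow by bounding the number of primes dividing `n`. -/

/-! ### Zero-sums over a prime field -/

/-- Upper bound for the Davenport constant of an elementary abelian `p`-group of rank `r`. -/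
theorem exists_zero_sum_of_lt_card {ι : Type*} {p r : ℕ} [Fact p.Prime]
    (v : ι → Fin r → ZMod p) (s : Finset ι) (hs : r * (p - 1) < s.card) :
    ∃ I ⊆ s, I.Nonempty ∧ ∑ i ∈ I, v i = 0 := by
  classical
  have hp1 : p - 1 ≠ 0 := Nat.sub_ne_zero_of_lt (Fact.out : p.Prime).one_lt
  -- Since `x ^ (p - 1)` is `0` or `1`, the support of a nonzero common root is a zero-sum set.
  let f : Fin r → MvPolynomial s (ZMod p) := fun j =>
    ∑ i : s, MvPolynomial.C (v i j) * MvPolynomial.X i ^ (p - 1)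
  have hdeg : ∀ j, (f j).totalDegree ≤ p - 1 := fun j => by
    refine MvPolynomial.totalDegree_finsetSum_le fun i _ => ?_
    refine (MvPolynomial.totalDegree_mul _ _).trans ?_
    simp
  have hsum : ∑ j, (f j).totalDegree < Fintype.card s := by
    calc ∑ j, (f j).totalDegree ≤ ∑ _j : Fin r, (p - 1) := Finset.sum_le_sum fun j _ => hdeg j
      _ < Fintype.card s := by simpa using hs
  have hdvd := char_dvd_card_solutions_of_fintype_sum_lt p hsum
  have h0 : ∀ j, MvPolynomial.eval (0 : s → ZMod p) (f j) = 0 := fun j => by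
    simp [f, hp1]
  have hcard : 1 < Fintype.card {x : s → ZMod p // ∀ j, MvPolynomial.eval x (f j) = 0} := by
    have hpos : 0 < Fintype.card {x : s → ZMod p // ∀ j, MvPolynomial.eval x (f j) = 0} :=
      Fintype.card_pos_iff.2 ⟨⟨0, h0⟩⟩
    exact (Fact.out : p.Prime).one_lt.trans_le (Nat.le_of_dvd hpos (by convert hdvd))
  obtain ⟨⟨x, hx⟩, hne⟩ := Fintype.exists_ne_of_one_lt_card hcard ⟨0, h0⟩
  have hx0 : x ≠ 0 := fun h => hne (Subtype.ext h)
  obtain ⟨i₀, hi₀⟩ := Function.ne_iff.1 hx0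
  refine ⟨(Finset.univ.filter fun i : s => x i ≠ 0).map (Function.Embedding.subtype _), ?_, ?_, ?_⟩
  · intro i hi
    simp only [Finset.mem_map] at hi
    obtain ⟨a, -, rfl⟩ := hi
    exact a.2
  · exact ⟨i₀, by simpa using hi₀⟩
  · ext j
    have := hx j
    simp only [f, map_sum, map_mul, MvPolynomial.eval_C, map_pow, MvPolynomial.eval_X] at this
    rw [Finset.sum_map, Finset.sum_apply, Finset.sum_filter, Pi.zero_apply]
    refine Eq.trans ?_ this
    refine Finset.sum_congr rfl fun i _ => ?_
    by_cases h : x i = 0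
    · simp [h, hp1]
    · simp [h, ZMod.pow_card_sub_one_eq_one h]

/-- In `C_p ⊕ C_p`, a sequence of length `3 p - 2` has a short zero-sum subsequence. -/
theorem exists_short_zero_sum {ι : Type*} {p : ℕ} [Fact p.Prime]
    (v : ι → Fin 2 → ZMod p) (s : Finset ι) (hs : 3 * p - 2 ≤ s.card) :
    ∃ I ⊆ s, I.Nonempty ∧ I.card ≤ p ∧ ∑ i ∈ I, v i = 0 := by
  classical
  have hp := (Fact.out : p.Prime).two_le
  obtain ⟨t, hts, ht⟩ := Finset.exists_subset_card_eq hs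
  -- The extra coordinate `1` makes the length of the zero-sum divisible by `p`, hence `p` or `2 *
  -- p`.
  obtain ⟨I, hIt, hI, h0⟩ := exists_zero_sum_of_lt_card (r := 3)
    (fun i => (Fin.cons 1 (v i) : Fin 3 → ZMod p)) t (by omega)
  have hv : ∑ i ∈ I, v i = 0 := by
    ext j
    simpa using congrFun h0 j.succ
  have hc : p ∣ I.card := by
    rw [← ZMod.natCast_eq_zero_iff]
    simpa using congrFun h0 0
  have hle := Finset.card_le_card hIt
  by_cases hIp : I.card ≤ p
  · exact ⟨I, hIt.trans hts, hI, hIp, hv⟩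
  have hI2 : I.card = 2 * p := by
    obtain ⟨c, hc⟩ := hc
    have h1 : 1 < c := by by_contra! h; interval_cases c <;> omega
    have h2 : c < 3 := by
      by_contra! h
      have := Nat.mul_le_mul_left p h
      omega
    have : c = 2 := by omega
    subst this
    omega
  -- Split length `2 * p` into two zero-sums, one of length at most `p`; setting `x` aside keeps the
  -- complement of `J` non-empty.
  obtain ⟨x, hx⟩ := hI
  obtain ⟨J, hJ, hJne, hJ0⟩ := exists_zero_sum_of_lt_card v (I.erase x) (by
    rw [Finset.card_erase_of_mem hx]; omega)
  have hJI : J ⊆ I := hJ.trans (Finset.erase_subset _ _)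
  have hsd := Finset.card_sdiff_add_card_eq_card hJI
  by_cases hJp : J.card ≤ p
  · exact ⟨J, (hJI.trans hIt).trans hts, hJne, hJp, hJ0⟩
  · refine ⟨I \ J, (Finset.sdiff_subset.trans hIt).trans hts, ⟨x, ?_⟩, by omega, ?_⟩
    · exact Finset.mem_sdiff.2 ⟨hx, fun h => (Finset.mem_erase.1 (hJ h)).1 rfl⟩
    · have := Finset.sum_sdiff (f := v) hJI
      rwa [hJ0, hv, add_zero] at this

/-! ### Disjoint blocks and contraction -/

/-- Repeated extraction of zero-sum blocks: besides the singletons of terms equal to zero, a long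
sequence contains many disjoint zero-sum subsequences. -/
theorem exists_disjoint_zero_sum {ι A : Type*} [DecidableEq ι] [AddCommMonoid A] (v : ι → A)
    {q D : ℕ}
    (hD : ∀ s : Finset ι, D ≤ s.card → ∃ I ⊆ s, I.Nonempty ∧ ∑ i ∈ I, v i = 0)
    (hη : ∀ s : Finset ι, D + q ≤ s.card → ∃ I ⊆ s, I.Nonempty ∧ I.card ≤ q ∧ ∑ i ∈ I, v i = 0)
    (T : Finset ι) (hT : ∀ i ∈ T, v i = 0) (k : ℕ) :
    ∀ s : Finset ι, Disjoint T s → (k = 0 ∨ D + k * q ≤ s.card + q) →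
      ∃ F : Finset (Finset ι), F.card = T.card + k ∧ (F : Set (Finset ι)).PairwiseDisjoint id ∧
        ∀ I ∈ F, I ⊆ T ∪ s ∧ I.Nonempty ∧ ∑ i ∈ I, v i = 0 := by
  have hadd : ∀ (F : Finset (Finset ι)) (s I : Finset ι), Disjoint T s → I ⊆ s → I.Nonempty →
      ∑ i ∈ I, v i = 0 → (F : Set (Finset ι)).PairwiseDisjoint id →
      (∀ J ∈ F, J ⊆ T ∪ s \ I ∧ J.Nonempty ∧ ∑ i ∈ J, v i = 0) →
      (insert I F).card = F.card + 1 ∧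
        ((insert I F : Finset (Finset ι)) : Set (Finset ι)).PairwiseDisjoint id ∧
        ∀ J ∈ insert I F, J ⊆ T ∪ s ∧ J.Nonempty ∧ ∑ i ∈ J, v i = 0 := by
    intro F s I hTs hIs hI hI0 hF hF'
    have hdisj : ∀ J ∈ F, Disjoint I J := fun J hJ => by
      refine Finset.disjoint_of_subset_right (hF' J hJ).1 ?_
      exact Finset.disjoint_union_right.2
        ⟨(Finset.disjoint_of_subset_right hIs hTs).symm, Finset.disjoint_sdiff⟩
    have hIF : I ∉ F := fun h => hI.ne_empty (disjoint_self.1 (hdisj I h))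
    refine ⟨Finset.card_insert_of_notMem hIF, ?_, ?_⟩
    · rw [Finset.coe_insert]
      exact hF.insert fun J hJ _ => hdisj J hJ
    · intro J hJ
      rcases Finset.mem_insert.1 hJ with rfl | hJ
      · exact ⟨hIs.trans Finset.subset_union_right, hI, hI0⟩
      · exact ⟨(hF' J hJ).1.trans (Finset.union_subset_union_right Finset.sdiff_subset),
          (hF' J hJ).2⟩
  induction k with
  | zero =>
    intro s _ _
    refine ⟨T.image fun i => {i}, ?_, ?_, ?_⟩
    · rw [Finset.card_image_of_injective _ Finset.singleton_injective, add_zero]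
    · intro I hI J hJ hIJ
      simp only [Finset.coe_image, Set.mem_image, Finset.mem_coe] at hI hJ
      obtain ⟨i, -, rfl⟩ := hI
      obtain ⟨j, -, rfl⟩ := hJ
      simpa [Function.onFun] using hIJ
    · intro I hI
      obtain ⟨i, hi, rfl⟩ := Finset.mem_image.1 hI
      simp [hi, hT i hi]
  | succ k ih =>
    intro s hTs hs
    have hsub : ∀ I, Disjoint T (s \ I) := fun I =>
      Finset.disjoint_of_subset_right Finset.sdiff_subset hTs
    rw [add_mul, one_mul] at hs
    replace hs := hs.resolve_left k.succ_ne_zero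
    -- Only the last block may be long, as nothing is extracted after it.
    obtain ⟨I, hIs, hI, hIq, hI0⟩ : ∃ I ⊆ s, I.Nonempty ∧ (k = 0 ∨ I.card ≤ q) ∧
        ∑ i ∈ I, v i = 0 := by
      rcases Nat.eq_zero_or_pos k with rfl | hk
      · obtain ⟨I, h1, h2, h3⟩ := hD s (by omega)
        exact ⟨I, h1, h2, Or.inl rfl, h3⟩
      · have := Nat.le_mul_of_pos_left q hk
        obtain ⟨I, h1, h2, h3, h4⟩ := hη s (by omega)
        exact ⟨I, h1, h2, Or.inr h3, h4⟩
    have hc := Finset.card_sdiff_add_card_eq_card hIs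
    obtain ⟨F, hF1, hF2, hF3⟩ := ih (s \ I) (hsub I) (by omega)
    obtain ⟨h1, h2, h3⟩ := hadd F s I hTs hIs hI hI0 hF2 hF3
    exact ⟨_, by omega, h2, h3⟩

/-- `D(C_m ⊕ C_k) ≤ m + k - 1`, with group elements represented by pairs of integers. -/
def DavenportBound (m k : ℕ) : Prop :=
  ∀ (ι : Type) (s : Finset ι) (a b : ι → ℤ), m + k - 1 ≤ s.card →
    ∃ I ⊆ s, I.Nonempty ∧ (m : ℤ) ∣ ∑ i ∈ I, a i ∧ (k : ℤ) ∣ ∑ i ∈ I, b i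

/-- Disjoint blocks with sums in a subgroup `C_m' ⊕ C_k'` can be combined to a zero-sum. -/
theorem DavenportBound.of_blocks {m k : ℕ} (h : DavenportBound m k) (c d : ℕ)
    {ι : Type} [DecidableEq ι] (a b : ι → ℤ) (s : Finset ι) (F : Finset (Finset ι))
    (hcard : m + k - 1 ≤ F.card) (hF : (F : Set (Finset ι)).PairwiseDisjoint id)
    (hF' : ∀ I ∈ F, I ⊆ s ∧ I.Nonempty ∧ (c : ℤ) ∣ ∑ i ∈ I, a i ∧ (d : ℤ) ∣ ∑ i ∈ I, b i) :
    ∃ I ⊆ s, I.Nonempty ∧ ((c * m : ℕ) : ℤ) ∣ ∑ i ∈ I, a i ∧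
      ((d * k : ℕ) : ℤ) ∣ ∑ i ∈ I, b i := by
  obtain ⟨J, hJF, ⟨I₀, hI₀⟩, ha, hb⟩ := h (Finset ι) F (fun I => (∑ i ∈ I, a i) / c)
    (fun I => (∑ i ∈ I, b i) / d) hcard
  have key : ∀ (x : ι → ℤ) (e : ℕ), (∀ I ∈ F, (e : ℤ) ∣ ∑ i ∈ I, x i) →
      ∑ i ∈ J.biUnion id, x i = e * ∑ I ∈ J, (∑ i ∈ I, x i) / e := fun x e hx => by
    rw [Finset.sum_biUnion (hF.subset (by exact_mod_cast hJF)), Finset.mul_sum]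
    exact Finset.sum_congr rfl fun I hI => (Int.mul_ediv_cancel' (hx I (hJF hI))).symm
  refine ⟨J.biUnion id, Finset.biUnion_subset.2 fun I hI => (hF' I (hJF hI)).1, ?_, ?_, ?_⟩
  · obtain ⟨i, hi⟩ := (hF' I₀ (hJF hI₀)).2.1
    exact ⟨i, Finset.mem_biUnion.2 ⟨I₀, hI₀, hi⟩⟩
  · rw [key a c fun I hI => (hF' I hI).2.2.1, Nat.cast_mul]
    exact mul_dvd_mul_left _ ha
  · rw [key b d fun I hI => (hF' I hI).2.2.2, Nat.cast_mul]
    exact mul_dvd_mul_left _ hb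

/-- Contraction along `C_{qm} ⊕ C_{qk} → C_q ⊕ C_q`. -/
theorem DavenportBound.exists_zero_sum_of_rank_two {m k q : ℕ} (h : DavenportBound m k)
    (hq : q.Prime) {ι : Type} [DecidableEq ι] (a b : ι → ℤ) (T s : Finset ι) (hTs : Disjoint T s)
    (hT : ∀ i ∈ T, (q : ℤ) ∣ a i ∧ (q : ℤ) ∣ b i) (j : ℕ) (hj : m + k - 1 ≤ T.card + j)
    (hs : j = 0 ∨ q + j * q ≤ s.card + 1) :
    ∃ I ⊆ T ∪ s, I.Nonempty ∧ ((q * m : ℕ) : ℤ) ∣ ∑ i ∈ I, a i ∧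
      ((q * k : ℕ) : ℤ) ∣ ∑ i ∈ I, b i := by
  have := Fact.mk hq
  have hq2 := hq.two_le
  have hv : ∀ I : Finset ι, ∑ i ∈ I, (![(a i : ZMod q), (b i : ZMod q)] : Fin 2 → ZMod q) = 0 ↔
      (q : ℤ) ∣ ∑ i ∈ I, a i ∧ (q : ℤ) ∣ ∑ i ∈ I, b i := fun I => by
    rw [← CharP.intCast_eq_zero_iff (ZMod q) q, ← CharP.intCast_eq_zero_iff (ZMod q) q, funext_iff,
      Fin.forall_fin_two]
    simp
  obtain ⟨F, hF1, hF2, hF3⟩ := exists_disjoint_zero_sum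
    (fun i => (![(a i : ZMod q), (b i : ZMod q)] : Fin 2 → ZMod q)) (q := q) (D := 2 * q - 1)
    (fun s hs => exists_zero_sum_of_lt_card _ s (by omega))
    (fun s hs => exists_short_zero_sum _ s (by omega)) T
    (fun i hi => by simpa using (hv {i}).2 (by simpa using hT i hi)) j s hTs (by omega)
  exact h.of_blocks q q a b _ F (by omega) hF2 fun I hI =>
    ⟨(hF3 I hI).1, (hF3 I hI).2.1, (hv I).1 (hF3 I hI).2.2⟩

/-- Contraction along `C_m ⊕ C_{qk} → C_q`. -/
theorem DavenportBound.exists_zero_sum_of_cyclic {m k q : ℕ} (h : DavenportBound m k)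
    (hq : q.Prime) {ι : Type} [DecidableEq ι] (a b : ι → ℤ) (T s : Finset ι) (hTs : Disjoint T s)
    (hT : ∀ i ∈ T, (q : ℤ) ∣ b i) (j : ℕ) (hj : m + k - 1 ≤ T.card + j)
    (hs : j * q ≤ s.card) :
    ∃ I ⊆ T ∪ s, I.Nonempty ∧ (m : ℤ) ∣ ∑ i ∈ I, a i ∧ ((q * k : ℕ) : ℤ) ∣ ∑ i ∈ I, b i := by
  have := Fact.mk hq
  have hq2 := hq.two_le
  have hv : ∀ I : Finset ι, ∑ i ∈ I, (![(b i : ZMod q)] : Fin 1 → ZMod q) = 0 ↔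
      (q : ℤ) ∣ ∑ i ∈ I, b i := fun I => by
    rw [← CharP.intCast_eq_zero_iff (ZMod q) q, funext_iff, Fin.forall_fin_one]
    simp
  have hD : ∀ s : Finset ι, q ≤ s.card → ∃ I ⊆ s, I.Nonempty ∧ I.card ≤ q ∧
      ∑ i ∈ I, (![(b i : ZMod q)] : Fin 1 → ZMod q) = 0 := fun s hs => by
    obtain ⟨t, hts, ht⟩ := Finset.exists_subset_card_eq hs
    obtain ⟨I, hI, h1, h2⟩ := exists_zero_sum_of_lt_card
      (fun i => (![(b i : ZMod q)] : Fin 1 → ZMod q)) t (by omega)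
    exact ⟨I, hI.trans hts, h1, (Finset.card_le_card hI).trans ht.le, h2⟩
  obtain ⟨F, hF1, hF2, hF3⟩ := exists_disjoint_zero_sum
    (fun i => (![(b i : ZMod q)] : Fin 1 → ZMod q)) (q := q) (D := q)
    (fun s hs => (hD s hs).imp fun I hI => ⟨hI.1, hI.2.1, hI.2.2.2⟩)
    (fun s hs => hD s (by omega)) T
    (fun i hi => by simpa using (hv {i}).2 (by simpa using hT i hi)) j s hTs (by omega)
  simpa using h.of_blocks 1 q a b _ F (by omega) hF2 fun I hI =>
    ⟨(hF3 I hI).1, (hF3 I hI).2.1, by simp, (hv I).1 (hF3 I hI).2.2⟩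

/-- Contract by a prime `q ∣ m` in both coordinates, or by `q ∣ n` in the second alone once `m = 1`;
the quotient keeps the form `C_l ⊕ C_{ln}`. -/
theorem davenportBound (m n : ℕ) (hm : 1 ≤ m) (hn : 1 ≤ n) : DavenportBound m (m * n) := by
  classical
  induction hN : m * n using Nat.strong_induction_on generalizing m n with
  | _ N ih =>
  subst hN
  intro ι s a b hs
  by_cases hm1 : m = 1
  · subst hm1
    by_cases hn1 : n = 1
    · subst hn1
      obtain ⟨i, hi⟩ := Finset.card_pos.1 (by omega : 0 < s.card)
      exact ⟨{i}, by simpa using hi, by simp, by simp, by simp⟩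
    · obtain ⟨q, hq, k, rfl⟩ := Nat.exists_prime_and_dvd hn1
      have hk : 1 ≤ k := Nat.pos_of_ne_zero (by rintro rfl; simp at hn)
      have hlt : 1 * k < 1 * (q * k) := by
        have := Nat.mul_le_mul_right k hq.two_le
        omega
      have h := ih _ hlt 1 k le_rfl hk rfl
      have := h.exists_zero_sum_of_cyclic hq a b ∅ s (by simp) (by simp) k (by simp)
        (by rw [mul_comm k]; omega)
      simpa using this
  · obtain ⟨q, hq, l, rfl⟩ := Nat.exists_prime_and_dvd hm1
    have hl : 1 ≤ l := Nat.pos_of_ne_zero (by rintro rfl; simp at hm)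
    have hln : 1 ≤ l * n := Nat.mul_pos hl hn
    have hlt : l * n < q * l * n := by
      have := Nat.mul_le_mul_right (l * n) hq.two_le
      rw [mul_assoc]
      omega
    have h := ih _ hlt l n hl hn rfl
    obtain ⟨j, hj⟩ : ∃ j, l + l * n = j + 1 := ⟨l + l * n - 1, by omega⟩
    have hq2 := hq.two_le
    have e : q + j * q = q * l + q * l * n := by
      calc q + j * q = q * (j + 1) := by ring
        _ = _ := by rw [← hj]; ring
    have := h.exists_zero_sum_of_rank_two hq a b ∅ s (by simp) (by simp) j (by simp; omega)
      (by omega)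
    simpa [mul_assoc] using this

/-! ### Divisibility in extremal sequences -/

/-- In a zero-sumfree sequence of maximal length, no term is a multiple of a prime `q ∣ m`. -/
theorem not_dvd_of_zero_sumfree {m n q : ℕ} (hm : 1 ≤ m) (hn : 1 ≤ n) (hq : q.Prime) (hqm : q ∣ m)
    {ι : Type} (a b : ι → ℤ) (s : Finset ι) (hs : m + m * n - 2 ≤ s.card)
    (hfree : ∀ I ⊆ s, I.Nonempty → ¬ ((m : ℤ) ∣ ∑ i ∈ I, a i ∧ ((m * n : ℕ) : ℤ) ∣ ∑ i ∈ I, b i))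
    {i : ι} (hi : i ∈ s) : ¬ ((q : ℤ) ∣ a i ∧ (q : ℤ) ∣ b i) := by
  classical
  intro hdvd
  obtain ⟨l, rfl⟩ := hqm
  have hl : 1 ≤ l := Nat.pos_of_ne_zero (by rintro rfl; simp at hm)
  have hln : 1 ≤ l * n := Nat.mul_pos hl hn
  -- The singleton is one block, so one fewer must be extracted; the saving of `q ≥ 2` terms covers
  -- the missing length.
  obtain ⟨j, hj⟩ : ∃ j, l + l * n = j + 2 := ⟨l + l * n - 2, by omega⟩
  have hq2 := hq.two_le
  have e : 2 * q + j * q = q * l + q * l * n := by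
    calc 2 * q + j * q = q * (j + 2) := by ring
      _ = _ := by rw [← hj]; ring
  obtain ⟨I, hI, hne, h1, h2⟩ := (davenportBound l n hl hn).exists_zero_sum_of_rank_two hq a b {i}
    (s.erase i) (by simp) (by simpa using hdvd) j (by simp; omega)
    (by rw [Finset.card_erase_of_mem hi]; omega)
  refine hfree I (hI.trans (Finset.union_subset (by simpa using hi) (Finset.erase_subset _ _)))
    hne ⟨h1, ?_⟩
  rwa [mul_assoc]

/-- In a zero-sumfree sequence of maximal length, at most `m - 1` terms have order dividing
`m * n / q`, for each prime `q ∣ n`. -/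
theorem card_filter_dvd_lt_of_zero_sumfree {m n q : ℕ} (hm : 1 ≤ m) (hn : 1 ≤ n) (hq : q.Prime)
    (hqn : q ∣ n) {ι : Type} (a b : ι → ℤ) (s : Finset ι) (hs : m + m * n - 2 ≤ s.card)
    (hfree : ∀ I ⊆ s, I.Nonempty →
      ¬ ((m : ℤ) ∣ ∑ i ∈ I, a i ∧ ((m * n : ℕ) : ℤ) ∣ ∑ i ∈ I, b i)) :
    (s.filter fun i => (q : ℤ) ∣ b i).card < m := by
  classical
  by_contra! hcard
  obtain ⟨T, hT, hTm⟩ := Finset.exists_subset_card_eq hcard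
  have hTs : T ⊆ s := hT.trans (Finset.filter_subset _ _)
  obtain ⟨k, rfl⟩ := hqn
  have hk : 1 ≤ k := Nat.pos_of_ne_zero (by rintro rfl; simp at hn)
  have hmk : 1 ≤ m * k := Nat.mul_pos hm hk
  obtain ⟨j, hj⟩ : ∃ j, m * k = j + 1 := ⟨m * k - 1, by omega⟩
  have e : j * q + q = m * (q * k) := by
    calc j * q + q = q * (j + 1) := by ring
      _ = _ := by rw [← hj]; ring
  have hsd := Finset.card_sdiff_add_card_eq_card hTs
  have hq2 := hq.two_le
  obtain ⟨I, hI, hne, h1, h2⟩ := (davenportBound m k hm hk).exists_zero_sum_of_cyclic hq a b T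
    (s \ T) Finset.disjoint_sdiff (fun i hi => (Finset.mem_filter.1 (hT hi)).2) j (by omega)
    (by omega)
  refine hfree I (hI.trans (Finset.union_subset hTs Finset.sdiff_subset)) hne ⟨h1, ?_⟩
  rwa [mul_left_comm]

/-- `n` is at least the product of its distinct primes, all of which are at least `3` except
possibly one `2`. -/
theorem five_mul_card_primeFactors_le (n : ℕ) (hn : 1 ≤ n) : 5 * n.primeFactors.card ≤ n + 5 := by
  have hprod : ∏ p ∈ n.primeFactors, p ≤ n := Nat.le_of_dvd hn (Nat.prod_primeFactors_dvd n)
  have herase : 3 ^ (n.primeFactors.erase 2).card ≤ ∏ p ∈ n.primeFactors.erase 2, p := by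
    refine Finset.pow_card_le_prod _ _ _ fun p hp => ?_
    obtain ⟨h2, hp⟩ := Finset.mem_erase.1 hp
    have := (Nat.prime_of_mem_primeFactors hp).two_le
    omega
  have hpow : ∀ k : ℕ, 5 * k ≤ 2 * 3 ^ k := fun k => by
    induction k with
    | zero => simp
    | succ k ih =>
      have : 1 ≤ 3 ^ k := Nat.one_le_pow _ _ (by norm_num)
      rcases k with _ | k
      · norm_num
      · have : 1 ≤ 3 ^ k := Nat.one_le_pow _ _ (by norm_num)
        rw [pow_succ] at *
        omega
  by_cases h2 : 2 ∈ n.primeFactors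
  · rw [← Finset.mul_prod_erase _ _ h2] at hprod
    have := hpow (n.primeFactors.erase 2).card
    have := Finset.card_erase_add_one h2
    omega
  · rw [Finset.erase_eq_of_notMem h2] at herase
    have hlow : ∀ k : ℕ, 5 * k ≤ 3 ^ k + 5 := fun k => by
      rcases k with _ | k
      · simp
      · have := hpow k
        rw [pow_succ]
        omega
    have := hlow n.primeFactors.card
    omega

/-! ### Transfer to the group and order count -/

theorem isZeroSumfree_iff {G : Type*} [AddCommGroup G] {ℓ : ℕ} (S : Fin ℓ → G) :
    IsZeroSumfree S ↔ ∀ I : Finset (Fin ℓ), I.Nonempty → ∑ i ∈ I, S i ≠ 0 := by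
  simp [IsZeroSumfree, subsums, eq_comm]

/-- Integers representing the coordinates of an element of `C_m ⊕ C_k`. -/
theorem exists_int_coordinates {G ι : Type*} [AddCommGroup G] {m k : ℕ}
    (e : G ≃+ ZMod m × ZMod k) (S : ι → G) :
    ∃ a b : ι → ℤ, (∀ I : Finset ι, ∑ i ∈ I, S i = 0 ↔
        (m : ℤ) ∣ ∑ i ∈ I, a i ∧ (k : ℤ) ∣ ∑ i ∈ I, b i) ∧
      ∀ (N : ℕ) (i : ι), addOrderOf (S i) ∣ N ↔ (m : ℤ) ∣ N * a i ∧ (k : ℤ) ∣ N * b i := by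
  refine ⟨fun i => (e (S i)).1.cast, fun i => (e (S i)).2.cast, fun I => ?_, fun N i => ?_⟩
  · rw [← CharP.intCast_eq_zero_iff (ZMod m) m, ← CharP.intCast_eq_zero_iff (ZMod k) k,
      ← e.map_eq_zero_iff, Prod.ext_iff]
    simp [Prod.fst_sum, Prod.snd_sum]
  · rw [addOrderOf_dvd_iff_nsmul_eq_zero, ← CharP.intCast_eq_zero_iff (ZMod m) m,
      ← CharP.intCast_eq_zero_iff (ZMod k) k, ← e.map_eq_zero_iff, Prod.ext_iff]
    simp

/-- A zero-sumfree sequence of length `m + m n - 2`: `m - 1` copies of one basis element and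
`m n - 1` copies of the other. -/
theorem exists_isZeroSumfree {G : Type*} [AddCommGroup G] {m k : ℕ} (hm : 1 ≤ m) (hk : 1 ≤ k)
    (e : G ≃+ ZMod m × ZMod k) : ∃ S : Fin (m + k - 2) → G, IsZeroSumfree S := by
  refine ⟨fun i => e.symm (if i.val < m - 1 then (1, 0) else (0, 1)), ?_⟩
  rw [isZeroSumfree_iff]
  intro I hI h0
  rw [← map_sum, map_eq_zero_iff _ e.symm.injective, Prod.ext_iff] at h0
  simp only [Finset.sum_ite, Finset.sum_const, Prod.fst_add, Prod.snd_add, Prod.smul_fst,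
    Prod.smul_snd, smul_zero, add_zero, zero_add, nsmul_one, Prod.fst_zero, Prod.snd_zero,
    CharP.cast_eq_zero_iff (ZMod m) m, CharP.cast_eq_zero_iff (ZMod k) k] at h0
  have h1 : (I.filter fun i => i.val < m - 1).card ≤ m - 1 := by
    rw [← Finset.card_range (m - 1)]
    exact Finset.card_le_card_of_injOn Fin.val (fun i hi => by simp_all)
      Fin.val_injective.injOn
  have h2 : (I.filter fun i => ¬ i.val < m - 1).card ≤ k - 1 := by
    have : k - 1 = (Finset.Ico (m - 1) (m + k - 2)).card := by rw [Nat.card_Ico]; omega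
    rw [this]
    exact Finset.card_le_card_of_injOn Fin.val
      (fun i hi => by have := i.2; simp_all) Fin.val_injective.injOn
  have h3 := Nat.eq_zero_of_dvd_of_lt h0.1 (by omega)
  have h4 := Nat.eq_zero_of_dvd_of_lt h0.2 (by omega)
  have := Finset.card_filter_add_card_filter_not (s := I) fun i => i.val < m - 1
  have := hI.card_pos
  omega

theorem length_le_of_isZeroSumfree {G : Type*} [AddCommGroup G] {m n : ℕ} (hm : 1 ≤ m)
    (hn : 1 ≤ n) (e : G ≃+ ZMod m × ZMod (m * n)) {ℓ : ℕ} {S : Fin ℓ → G}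
    (hS : IsZeroSumfree S) : ℓ ≤ m + m * n - 2 := by
  obtain ⟨a, b, hab, -⟩ := exists_int_coordinates e S
  by_contra! h
  have := Nat.mul_pos hm hn
  obtain ⟨I, -, hI, h0⟩ := davenportBound m n hm hn _ Finset.univ a b
    (by rw [Finset.card_univ, Fintype.card_fin]; omega)
  exact (isZeroSumfree_iff S).1 hS I hI ((hab I).2 h0)

theorem maxZeroSumfreeLength_eq {G : Type*} [AddCommGroup G] {m n : ℕ} (hm : 1 ≤ m)
    (hn : 1 ≤ n) (e : G ≃+ ZMod m × ZMod (m * n)) :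
    maxZeroSumfreeLength G = m + m * n - 2 :=
  IsGreatest.csSup_eq ⟨exists_isZeroSumfree hm (Nat.mul_pos hm hn) e,
    fun _ ⟨_, hS⟩ => length_le_of_isZeroSumfree hm hn e hS⟩

/-- A zero-sumfree sequence of maximal length has at most `ω(n) (m - 1)` terms whose order is not
`m n`. -/
theorem length_le_orderCount_add {G : Type*} [AddCommGroup G] {m n : ℕ} (hm : 1 ≤ m)
    (hn : 1 ≤ n) (e : G ≃+ ZMod m × ZMod (m * n)) {ℓ : ℕ} {S : Fin ℓ → G}
    (hS : IsZeroSumfree S) (hℓ : ℓ = m + m * n - 2) :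
    ℓ ≤ orderCount S (m * n) + n.primeFactors.card * (m - 1) := by
  classical
  obtain ⟨a, b, hab, hord⟩ := exists_int_coordinates e S
  have hfree : ∀ I ⊆ (Finset.univ : Finset (Fin ℓ)), I.Nonempty →
      ¬ ((m : ℤ) ∣ ∑ i ∈ I, a i ∧ ((m * n : ℕ) : ℤ) ∣ ∑ i ∈ I, b i) := fun I _ hI h =>
    (isZeroSumfree_iff S).1 hS I hI ((hab I).2 h)
  have hcard : m + m * n - 2 ≤ (Finset.univ : Finset (Fin ℓ)).card := by simp [hℓ]
  have hmn : 0 < m * n := Nat.mul_pos hm hn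
  have hsub : (Finset.univ.filter fun i => ¬ addOrderOf (S i) = m * n) ⊆
      n.primeFactors.biUnion fun q => Finset.univ.filter fun i => (q : ℤ) ∣ b i := by
    intro i hi
    have hne := (Finset.mem_filter.1 hi).2
    obtain ⟨c, hc⟩ : addOrderOf (S i) ∣ m * n := by
      rw [hord]
      push_cast
      exact ⟨⟨n * a i, by ring⟩, dvd_mul_right _ _⟩
    have hc1 : c ≠ 1 := by
      rintro rfl
      exact hne (by omega)
    obtain ⟨q, hq, d, rfl⟩ := Nat.exists_prime_and_dvd hc1
    have hN : m * n = q * (addOrderOf (S i) * d) := by rw [hc]; ring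
    have hpos : 0 < addOrderOf (S i) * d := Nat.pos_of_ne_zero fun h => by simp [hN, h] at hmn
    -- The term is killed by `m * n / q`, so `q` divides its second coordinate; if `q ∤ n`, it
    -- divides the first as well, which is excluded.
    obtain ⟨h1, h2⟩ := (hord (addOrderOf (S i) * d) i).1 (dvd_mul_right _ _)
    have hqb : (q : ℤ) ∣ b i := by
      rw [hN, Nat.cast_mul, mul_comm] at h2
      exact Int.dvd_of_mul_dvd_mul_left (by exact_mod_cast hpos.ne') h2
    rw [Finset.mem_biUnion]
    refine ⟨q, ?_, by simpa using hqb⟩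
    by_contra hqn
    have hqn : ¬ q ∣ n := fun h => hqn (Nat.mem_primeFactors.2 ⟨hq, h, by omega⟩)
    have hqm : q ∣ m := (hq.dvd_mul.1 ⟨_, hN⟩).resolve_right hqn
    refine not_dvd_of_zero_sumfree hm hn hq hqm a b _ hcard hfree (Finset.mem_univ i) ⟨?_, hqb⟩
    obtain ⟨l, rfl⟩ := hqm
    have hl : l ≠ 0 := by rintro rfl; simp at hm
    have hN' : addOrderOf (S i) * d = l * n :=
      Nat.eq_of_mul_eq_mul_left hq.pos (by rw [← hN, mul_assoc])
    rw [hN', Nat.cast_mul, Nat.cast_mul, mul_comm (q : ℤ), mul_assoc] at h1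
    have h3 : (q : ℤ) ∣ n * a i := Int.dvd_of_mul_dvd_mul_left (by exact_mod_cast hl) h1
    refine ((Nat.prime_iff_prime_int.1 hq).dvd_or_dvd h3).resolve_left ?_
    exact_mod_cast hqn
  have hle := (Finset.card_le_card hsub).trans (Finset.card_biUnion_le_card_mul _ _ (m - 1)
    fun q hq => Nat.le_sub_one_of_lt <| card_filter_dvd_lt_of_zero_sumfree hm hn
      (Nat.prime_of_mem_primeFactors hq) (Nat.dvd_of_mem_primeFactors hq) a b _ hcard hfree)
  have := Finset.card_filter_add_card_filter_not (s := (Finset.univ : Finset (Fin ℓ)))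
    fun i => addOrderOf (S i) = m * n
  rw [Finset.card_univ, Fintype.card_fin] at this
  unfold orderCount
  omega

theorem mainTheorem2 {G : Type*} [AddCommGroup G] (m n : ℕ) (hm : 1 ≤ m) (hn : 1 ≤ n)
    (e : G ≃+ ZMod m × ZMod (m * n)) :
    maxZeroSumfreeLength G = m + m * n - 2 ∧
    ∀ (ℓ : ℕ) (S : Fin ℓ → G), IsZeroSumfree S → ℓ = maxZeroSumfreeLength G →
      ((∃ p a : ℕ, p.Prime ∧ n = p ^ a) → m * n - 1 ≤ orderCount S (m * n)) ∧
      ((¬ ∃ p a : ℕ, p.Prime ∧ n = p ^ a) →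
        ⌈(4 / 5 : ℚ) * ((m : ℚ) * (n : ℚ)) + ((n : ℚ) - 5) / 5⌉ ≤ (orderCount S (m * n) : ℤ)) := by
  have hmax := maxZeroSumfreeLength_eq hm hn e
  refine ⟨hmax, fun ℓ S hS hℓ => ?_⟩
  rw [hmax] at hℓ
  have hcount := length_le_orderCount_add hm hn e hS hℓ
  have hmn := Nat.mul_pos hm hn
  constructor
  · rintro ⟨p, a, hp, rfl⟩
    have hω : (p ^ a).primeFactors.card ≤ 1 :=
      (Finset.card_le_card fun q hq => Finset.mem_singleton.2 <|
        (Nat.prime_dvd_prime_iff_eq (Nat.prime_of_mem_primeFactors hq) hp).1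
          ((Nat.prime_of_mem_primeFactors hq).dvd_of_dvd_pow
            (Nat.dvd_of_mem_primeFactors hq))).trans (Finset.card_singleton p).le
    have := Nat.mul_le_mul_right (m - 1) hω
    omega
  · intro _
    have hω := Nat.mul_le_mul_right (m - 1) (five_mul_card_primeFactors_le n hn)
    obtain ⟨l, rfl⟩ : ∃ l, m = l + 1 := ⟨m - 1, by omega⟩
    rw [Nat.add_sub_cancel] at hcount hω
    have hlen : l + (l + 1) * n ≤ orderCount S ((l + 1) * n) + n.primeFactors.card * l + 1 := by
      omega
    rw [Int.ceil_le]
    have h1 : ((5 * n.primeFactors.card * l : ℕ) : ℚ) ≤ ((n + 5) * l : ℕ) := by exact_mod_cast hω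
    have h2 : ((l + (l + 1) * n : ℕ) : ℚ) ≤
      (orderCount S ((l + 1) * n) + n.primeFactors.card * l + 1 : ℕ) := by exact_mod_cast hlen
    push_cast at h1 h2 ⊢
    -- `m + m * n - 2 - (m - 1) * (n + 5) / 5` is exactly the stated bound.
    linarith
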